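/- **Setting.** A finite element discretization has $N_e$ elements of volumes $|\Omega_e|>0$, $N_u$ displacement degrees of freedom and $N_v$ vertices. Let $0<\rho_l<1$, let $p\ge 1$ be an integer, and let $\alpha(t)=\rho_l+(1-\rho_l)t^p$. The stiffness matrix and load are $$K(\rho)=\sum_e \alpha(\rho_e)P_eK_eP_e^T,\qquad f=\sum_e P_ef_e,$$ with assembly operators $P_e$, symmetric positive semidefinite element matrices $K_e$, and $\sum_e P_eK_eP_e^T$ positive definite. The Helmholtz filter uses $H=\sum_e Q_eH_eQ_e^T$ (symmetric positive definite) and $b(\psi)=\sum_e\psi_eQ_eb_e$. For $\psi\in\Psi=[0,1]^{N_e}$ let $\phi^\star(\psi)=H^{-1}b(\psi)$, and let $\rho^\star_e(\psi)=\frac1{N_v^e}\mathbf 1^TQ_e^T\phi^\star(\psi)$ be the average over the $N_v^e\ge1$ vertices of element $e$. The filter respects the bounds: $\rho^\star(\psi)\in P:=[0,1]^{N_e}$ for every $\psi\in\Psi$. Let $j:\mathbb R^{N_u}\times P\to\mathbb R$ be twice continuously differentiable. Let $u^\star(\psi)$ and $\lambda^\star(\psi)$ solve $$K(\rho^\star(\psi))u^\star=f,\qquad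 K(\rho^\star(\psi))^T\lambda^\star=\tfrac{\partial j}{\partial u}(u^\star(\psi),\rho^\star(\psi))^T.$$ Put $J(\psi)=j(u^\star(\psi),\rho^\star(\psi))$ and $r(u;\rho)=K(\rho)u-f$. The feasible set is $\mathcal C=\{\psi\in\Psi:\sum_e\psi_e|\Omega_e|\le V\}$ with $V\ge\sum_e\rho_l|\Omega_e|$. The criticality measure is $$\chi(\psi)=\Big|\min\{\langle\nabla J(\psi),d\rangle:\ \psi+d\in\mathcal C,\ \|d\|_2\le1\}\Big|.$$ Derivatives of functions of $\psi$ are taken on $\Psi$ (one-sided at the boundary). **Algorithm.** Fix $0<\gamma_1<\gamma_2<1$, $0<\eta_1<\eta_2<1$, $\kappa\in(0,1)$, $\kappa'>0$, $\varepsilon\in(0,1)$, $\Delta_{\max}$, an initial radius $0<\Delta_0\le\Delta_{\max}$, and $\psi^{(0)}\in\mathcal C$. In iteration $k=0,1,2,\dots$: 1. *Reduced basis.* Choose $0\le n_k\le\max(k-1,0)$. Let $\Phi_k$ be the matrix with orthonormal columns obtained by Gram–Schmidt (columns that depend linearly on earlier ones are dropped) from $[\mathrm{POD}_{n_k}(U_{k-1}),\mathrm{POD}_{n_k}(\Lambda_{k-1}),u^\star(\psi^{(k)}),\lambda^\star(\psi^{(k)})]$.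 Here $U_{k-1}$ and $\Lambda_{k-1}$ have the columns $u^\star(\psi^{(i)})$ and $\lambda^\star(\psi^{(i)})$, $i=0,\dots,k-1$, and $\mathrm{POD}_n(X)$ consists of the first $\min(n,N_u)$ left singular vectors of $X$ (from any singular value decomposition). 2. *Model and trust region.* Let $u_k(\psi)=\Phi_k\hat u$ with $\Phi_k^TK(\rho^\star(\psi))\Phi_k\hat u=\Phi_k^Tf$, and $$m_k(\psi)=j(u_k(\psi),\rho^\star(\psi)),\quad \vartheta_k(\psi)=\|r(u_k(\psi);\rho^\star(\psi))\|_2^{\,1-\varepsilon},\quad \mathcal B_k=\{\psi\in\mathcal C:\vartheta_k(\psi)\le\Delta_k\}.$$ 3. *Candidate.* Take $\hat\psi^{(k)}\in\mathcal B_k$ that satisfies the fraction of Cauchy decrease condition $$m_k(\psi^{(k)})-m_k(\hat\psi^{(k)})\ge\kappa\,\chi(\psi^{(k)})\min\Big[\tfrac{\chi(\psi^{(k)})}{\beta_k},\kappa'\Delta_k,1\Big],\qquad \beta_k=1+\max_{\mathcal C}\|\nabla^2m_k\|_2 .$$ 4. *Acceptance.* Let $\varrho_k=\dfrac{J(\psi^{(k)})-J(\hat\psi^{(k)})}{m_k(\psi^{(k)})-m_k(\hat\psi^{(k)})}$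 (with $0$ as its value if the denominator is $0$). Put $\psi^{(k+1)}=\hat\psi^{(k)}$ if $\varrho_k\ge\eta_1$, and $\psi^{(k+1)}=\psi^{(k)}$ otherwise. 5. *Radius.* Choose $\Delta_{k+1}\in[\gamma_1\Delta_k,\gamma_2\Delta_k]$ if $\varrho_k<\eta_1$, $\Delta_{k+1}\in[\gamma_2\Delta_k,\Delta_k]$ if $\eta_1\le\varrho_k<\eta_2$, and $\Delta_{k+1}\in[\Delta_k,\Delta_{\max}]$ if $\varrho_k\ge\eta_2$. **Theorem.** Every sequence of trust-region centers $(\psi^{(k)})$ produced by this algorithm satisfies $$\liminf_{k\to\infty}\chi(\psi^{(k)})=0,$$ regardless of the choice of the truncations $n_k$. -/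

import Mathlib

open Set Filter
open scoped Matrix

noncomputable section

namespace TopOpt

/-- A finite element discretization for density-based topology optimization with a Helmholtz
filter: `Ne` elements, `Nu` displacement degrees of freedom (those fixed by homogeneous Dirichlet
conditions are eliminated), `Nv` vertices.  The element matrices and vectors and the assembly
operators are the data of the mesh and of the load case; the assembled matrices are defined below.
The global stiffness matrix of the solid material (unit modulus in every element) and the
Helmholtz matrix are symmetric positive definite. -/
structure Discretization (Ne Nu Nv : ℕ) where
  /-- lower bound of the density, the relative stiffness of void -/
  rhoMin : ℝ
  /-- penalization exponent -/
  p : ℕ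
  /-- volumes of the elements -/
  vol : Fin Ne → ℝ
  /-- number of displacement degrees of freedom of an element -/
  nu : Fin Ne → ℕ
  /-- number of vertices of an element -/
  nv : Fin Ne → ℕ
  /-- assembly operator: `(P e)ᵀ *ᵥ v` is the element displacement vector of `v` -/
  P : (e : Fin Ne) → Matrix (Fin Nu) (Fin (nu e)) ℝ
  /-- element stiffness matrix for unit density -/
  Ke : (e : Fin Ne) → Matrix (Fin (nu e)) (Fin (nu e)) ℝ
  /-- element load vector -/
  fe : (e : Fin Ne) → Fin (nu e) → ℝ
  /-- Helmholtz assembly operator -/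
  Q : (e : Fin Ne) → Matrix (Fin Nv) (Fin (nv e)) ℝ
  /-- element Helmholtz stiffness matrix -/
  He : (e : Fin Ne) → Matrix (Fin (nv e)) (Fin (nv e)) ℝ
  /-- element Helmholtz load vector -/
  be : (e : Fin Ne) → Fin (nv e) → ℝ
  rhoMin_pos : 0 < rhoMin
  rhoMin_lt_one : rhoMin < 1
  one_le_p : 1 ≤ p
  vol_pos : ∀ e, 0 < vol e
  nv_pos : ∀ e, 0 < nv e
  Ke_posSemidef : ∀ e, (Ke e).PosSemidef
  solid_posDef : (∑ e, P e * Ke e * (P e)ᵀ).PosDef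
  helmholtz_posDef : (∑ e, Q e * He e * (Q e)ᵀ).PosDef

variable {Ne Nu Nv : ℕ}

/-- The space of (unfiltered) designs, with the Euclidean norm. -/
abbrev Design (Ne : ℕ) : Type := EuclideanSpace ℝ (Fin Ne)

/-- The box `Ψ = [0,1]^Ne` of admissible unfiltered densities. -/
def designBox (Ne : ℕ) : Set (Design Ne) := {ψ | ∀ e, ψ e ∈ Icc (0 : ℝ) 1}

/-- The box `[0,1]^Ne` of admissible filtered densities. -/
def densityBox (Ne : ℕ) : Set (Fin Ne → ℝ) := {ρ | ∀ e, ρ e ∈ Icc (0 : ℝ) 1}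

namespace Discretization

/-- The material model `α(ρ) = ρ_l + (1 - ρ_l) ρ^p`. -/
def alpha (M : Discretization Ne Nu Nv) (t : ℝ) : ℝ := M.rhoMin + (1 - M.rhoMin) * t ^ M.p

/-- The stiffness matrix `K(ρ)`. -/
def stiffness (M : Discretization Ne Nu Nv) (ρ : Fin Ne → ℝ) : Matrix (Fin Nu) (Fin Nu) ℝ :=
  ∑ e, M.alpha (ρ e) • (M.P e * M.Ke e * (M.P e)ᵀ)

/-- The load vector `f`. -/
def load (M : Discretization Ne Nu Nv) : Fin Nu → ℝ := ∑ e, M.P e *ᵥ M.fe e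

/-- The Helmholtz matrix `H`. -/
def helmholtz (M : Discretization Ne Nu Nv) : Matrix (Fin Nv) (Fin Nv) ℝ :=
  ∑ e, M.Q e * M.He e * (M.Q e)ᵀ

/-- The Helmholtz load `b(ψ)`. -/
def helmholtzLoad (M : Discretization Ne Nu Nv) (ψ : Design Ne) : Fin Nv → ℝ :=
  ∑ e, ψ e • (M.Q e *ᵥ M.be e)

/-- The nodal filtered density, the solution of `H φ = b(ψ)`. -/
def nodalDensity (M : Discretization Ne Nu Nv) (ψ : Design Ne) : Fin Nv → ℝ :=
  M.helmholtz⁻¹ *ᵥ M.helmholtzLoad ψ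

/-- The filtered element density `ρ⋆(ψ)`: the average over the vertices of each element. -/
def filteredDensity (M : Discretization Ne Nu Nv) (ψ : Design Ne) : Fin Ne → ℝ :=
  fun e => (1 / (M.nv e : ℝ)) * ∑ i, ((M.Q e)ᵀ *ᵥ M.nodalDensity ψ) i

/-- The residual `r(u; ρ) = K(ρ) u - f` of the elasticity equations. -/
def residual (M : Discretization Ne Nu Nv) (u : Fin Nu → ℝ) (ρ : Fin Ne → ℝ) : Fin Nu → ℝ :=
  M.stiffness ρ *ᵥ u - M.load

/-- The primal solution `u⋆(ψ)`, with `K(ρ⋆(ψ)) u⋆(ψ) = f`. -/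
def state (M : Discretization Ne Nu Nv) (ψ : Design Ne) : Fin Nu → ℝ :=
  (M.stiffness (M.filteredDensity ψ))⁻¹ *ᵥ M.load

/-- The column vector `(∂j/∂u)(u, ρ)ᵀ`. -/
def partialU (j : (Fin Nu → ℝ) × (Fin Ne → ℝ) → ℝ) (u : Fin Nu → ℝ) (ρ : Fin Ne → ℝ) :
    Fin Nu → ℝ :=
  fun i => fderiv ℝ (fun v => j (v, ρ)) u (Pi.single i 1)

/-- The adjoint solution `λ⋆(ψ)`, with `K(ρ⋆(ψ))ᵀ λ⋆(ψ) = (∂j/∂u)(u⋆(ψ), ρ⋆(ψ))ᵀ`. -/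
def adjoint (M : Discretization Ne Nu Nv) (j : (Fin Nu → ℝ) × (Fin Ne → ℝ) → ℝ)
    (ψ : Design Ne) : Fin Nu → ℝ :=
  ((M.stiffness (M.filteredDensity ψ))ᵀ)⁻¹ *ᵥ partialU j (M.state ψ) (M.filteredDensity ψ)

/-- The objective function `J(ψ) = j(u⋆(ψ), ρ⋆(ψ))`. -/
def objective (M : Discretization Ne Nu Nv) (j : (Fin Nu → ℝ) × (Fin Ne → ℝ) → ℝ)
    (ψ : Design Ne) : ℝ :=
  j (M.state ψ, M.filteredDensity ψ)

/-- The feasible set `𝒞`: box constraints and the volume constraint. -/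
def feasible (M : Discretization Ne Nu Nv) (V : ℝ) : Set (Design Ne) :=
  {ψ | ψ ∈ designBox Ne ∧ ∑ e, ψ e * M.vol e ≤ V}

/-- The criticality measure `χ(ψ) = |min {⟨∇J(ψ), d⟩ : ψ + d ∈ 𝒞, ‖d‖₂ ≤ 1}|`.  The derivative of
`J` is the one relative to its domain, the box `Ψ`. -/
def criticality (M : Discretization Ne Nu Nv) (j : (Fin Nu → ℝ) × (Fin Ne → ℝ) → ℝ) (V : ℝ)
    (ψ : Design Ne) : ℝ :=
  |sInf ((fun d : Design Ne => fderivWithin ℝ (M.objective j) (designBox Ne) ψ d) ''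
    {d | ψ + d ∈ M.feasible V ∧ ‖d‖ ≤ 1})|

/-- The reconstructed Galerkin solution `u_k⋆(ψ) = Φ û`, with `(Φᵀ K(ρ⋆(ψ)) Φ) û = Φᵀ f`. -/
def romState (M : Discretization Ne Nu Nv) {ι : Type} [Fintype ι] [DecidableEq ι]
    (Φ : Matrix (Fin Nu) ι ℝ) (ψ : Design Ne) : Fin Nu → ℝ :=
  Φ *ᵥ ((Φᵀ * M.stiffness (M.filteredDensity ψ) * Φ)⁻¹ *ᵥ (Φᵀ *ᵥ M.load))

/-- The reduced objective `J_k(ψ) = j(u_k⋆(ψ), ρ⋆(ψ))`. -/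
def romObjective (M : Discretization Ne Nu Nv) (j : (Fin Nu → ℝ) × (Fin Ne → ℝ) → ℝ)
    {ι : Type} [Fintype ι] [DecidableEq ι] (Φ : Matrix (Fin Nu) ι ℝ) (ψ : Design Ne) : ℝ :=
  j (M.romState Φ ψ, M.filteredDensity ψ)

/-- The Euclidean norm of the residual at the reconstructed reduced solution. -/
def romResidualNorm (M : Discretization Ne Nu Nv) {ι : Type} [Fintype ι] [DecidableEq ι]
    (Φ : Matrix (Fin Nu) ι ℝ) (ψ : Design Ne) : ℝ :=
  ‖WithLp.toLp 2 (M.residual (M.romState Φ ψ) (M.filteredDensity ψ))‖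

end Discretization

/-- `IsPOD X n Φ`: the `Φ i` are the first `n` left singular vectors of the snapshot matrix `X`
(all `N` of them if `n > N`), taken from some singular value decomposition
`X = W diag(s) Zᵀ` with nonincreasing singular values. -/
def IsPOD {N m : ℕ} (X : Matrix (Fin N) (Fin m) ℝ) (n : ℕ)
    (Φ : Fin (min n N) → EuclideanSpace ℝ (Fin N)) : Prop :=
  ∃ (W : Matrix (Fin N) (Fin N) ℝ) (Z : Matrix (Fin m) (Fin m) ℝ) (s : ℕ → ℝ),
    W ∈ Matrix.orthogonalGroup (Fin N) ℝ ∧ Z ∈ Matrix.orthogonalGroup (Fin m) ℝ ∧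
    Antitone s ∧ (∀ i, 0 ≤ s i) ∧
    X = W * (Matrix.of fun (a : Fin N) (b : Fin m) => if (a : ℕ) = (b : ℕ) then s a else 0) * Zᵀ ∧
    ∀ i a, Φ i a = W a (Fin.castLE (min_le_right n N) i)

/-- The index set of the vectors that Gram-Schmidt does not reduce to zero. -/
abbrev GramSchmidtIndex {N m : ℕ} (c : Fin m → EuclideanSpace ℝ (Fin N)) : Type :=
  {i : Fin m // InnerProductSpace.gramSchmidtNormed ℝ c i ≠ 0}

instance {N m : ℕ} (c : Fin m → EuclideanSpace ℝ (Fin N)) : Fintype (GramSchmidtIndex c) :=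
  Fintype.ofFinite _

/-- The matrix with orthonormal columns that the Gram-Schmidt procedure makes from the columns `c`;
a column that depends linearly on the preceding ones is dropped. -/
def gramSchmidtBasis {N m : ℕ} (c : Fin m → EuclideanSpace ℝ (Fin N)) :
    Matrix (Fin N) (GramSchmidtIndex c) ℝ :=
  Matrix.of fun a i => InnerProductSpace.gramSchmidtNormed ℝ c i a

/-- The columns `[A, B, u, l]` from which the reduced basis is built. -/
def basisColumns {N m : ℕ} (A B : Fin m → EuclideanSpace ℝ (Fin N)) (u l : Fin N → ℝ) :
    Fin (m + m + 2) → EuclideanSpace ℝ (Fin N) :=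
  Fin.append (Fin.append A B) ![WithLp.toLp 2 u, WithLp.toLp 2 l]

/-- The snapshot matrix `[w(ψ⁽⁰⁾), …, w(ψ⁽ᵏ⁻¹⁾)]` (empty for `k = 0`). -/
def snapshots {N : ℕ} (w : Design Ne → Fin N → ℝ) (ψ : ℕ → Design Ne) (k : ℕ) :
    Matrix (Fin N) (Fin k) ℝ :=
  Matrix.of fun a i => w (ψ i) a

/-- The constants of the algorithm: trust-region parameters, the constants of the fraction of
Cauchy decrease condition, and the exponent parameter `ε` of the trust-region constraint. -/
structure Parameters where
  gamma₁ : ℝ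
  gamma₂ : ℝ
  eta₁ : ℝ
  eta₂ : ℝ
  radMax : ℝ
  kappa : ℝ
  kappa' : ℝ
  eps : ℝ
  gamma₁_pos : 0 < gamma₁
  gamma₁_lt : gamma₁ < gamma₂
  gamma₂_lt : gamma₂ < 1
  eta₁_pos : 0 < eta₁
  eta₁_lt : eta₁ < eta₂
  eta₂_lt : eta₂ < 1
  kappa_pos : 0 < kappa
  kappa_lt : kappa < 1
  kappa'_pos : 0 < kappa'
  eps_pos : 0 < eps
  eps_lt : eps < 1

/-- `β = 1 + max_{ψ ∈ 𝒞} ‖∇²m(ψ)‖₂`. -/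
def hessianBound (M : Discretization Ne Nu Nv) (V : ℝ) (m : Design Ne → ℝ) : ℝ :=
  1 + sSup ((fun ψ => ‖iteratedFDerivWithin ℝ 2 m (designBox Ne) ψ‖) '' M.feasible V)

/-- A record of all iterations of the algorithm: trust-region centers, candidate steps, radii, and
the two POD bases of each iteration (`n k` is the truncation). -/
structure Trajectory (Ne Nu : ℕ) (n : ℕ → ℕ) where
  center : ℕ → Design Ne
  candidate : ℕ → Design Ne
  radius : ℕ → ℝ
  podPrimal : (k : ℕ) → Fin (min (n k) Nu) → EuclideanSpace ℝ (Fin Nu)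
  podAdjoint : (k : ℕ) → Fin (min (n k) Nu) → EuclideanSpace ℝ (Fin Nu)

namespace Trajectory

variable {n : ℕ → ℕ}

/-- The columns of the reduced basis at iteration `k` before orthonormalization. -/
def columns (T : Trajectory Ne Nu n) (M : Discretization Ne Nu Nv)
    (j : (Fin Nu → ℝ) × (Fin Ne → ℝ) → ℝ) (k : ℕ) :
    Fin (min (n k) Nu + min (n k) Nu + 2) → EuclideanSpace ℝ (Fin Nu) :=
  basisColumns (T.podPrimal k) (T.podAdjoint k) (M.state (T.center k)) (M.adjoint j (T.center k))

/-- The approximation model `m_k`: the Galerkin reduced objective. -/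
def model (T : Trajectory Ne Nu n) (M : Discretization Ne Nu Nv)
    (j : (Fin Nu → ℝ) × (Fin Ne → ℝ) → ℝ) (k : ℕ) (ψ : Design Ne) : ℝ :=
  M.romObjective j (gramSchmidtBasis (T.columns M j k)) ψ

/-- The trust-region constraint `ϑ_k(ψ) = ‖r(u_k⋆(ψ); ρ⋆(ψ))‖₂ ^ (1 - ε)`. -/
def trConstraint (T : Trajectory Ne Nu n) (M : Discretization Ne Nu Nv)
    (j : (Fin Nu → ℝ) × (Fin Ne → ℝ) → ℝ) (ε : ℝ) (k : ℕ) (ψ : Design Ne) : ℝ :=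
  M.romResidualNorm (gramSchmidtBasis (T.columns M j k)) ψ ^ (1 - ε)

/-- The trust region `ℬ_k = {ψ ∈ 𝒞 : ϑ_k(ψ) ≤ Δ_k}`. -/
def trustRegion (T : Trajectory Ne Nu n) (M : Discretization Ne Nu Nv)
    (j : (Fin Nu → ℝ) × (Fin Ne → ℝ) → ℝ) (V ε : ℝ) (k : ℕ) : Set (Design Ne) :=
  {ψ | ψ ∈ M.feasible V ∧ T.trConstraint M j ε k ψ ≤ T.radius k}

/-- The actual-to-predicted reduction ratio `ϱ_k`. -/
def ratio (T : Trajectory Ne Nu n) (M : Discretization Ne Nu Nv)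
    (j : (Fin Nu → ℝ) × (Fin Ne → ℝ) → ℝ) (k : ℕ) : ℝ :=
  (M.objective j (T.center k) - M.objective j (T.candidate k)) /
    (T.model M j k (T.center k) - T.model M j k (T.candidate k))

/-- The trajectory is produced by the ROM-based error-aware trust-region algorithm. -/
structure IsProducedBy (T : Trajectory Ne Nu n) (M : Discretization Ne Nu Nv)
    (j : (Fin Nu → ℝ) × (Fin Ne → ℝ) → ℝ) (V : ℝ) (c : Parameters) : Prop where
  center_zero_mem : T.center 0 ∈ M.feasible V
  radius_zero_pos : 0 < T.radius 0
  radius_zero_le : T.radius 0 ≤ c.radMax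
  /-- POD of the primal snapshots at the centers `0, …, k - 1` -/
  podPrimal_isPOD : ∀ k, IsPOD (snapshots M.state T.center k) (n k) (T.podPrimal k)
  /-- POD of the adjoint snapshots at the centers `0, …, k - 1` -/
  podAdjoint_isPOD : ∀ k, IsPOD (snapshots (M.adjoint j) T.center k) (n k) (T.podAdjoint k)
  candidate_mem : ∀ k, T.candidate k ∈ T.trustRegion M j V c.eps k
  /-- fraction of Cauchy decrease -/
  cauchy_decrease : ∀ k,
    c.kappa * M.criticality j V (T.center k) *
        min (M.criticality j V (T.center k) / hessianBound M V (T.model M j k))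
          (min (c.kappa' * T.radius k) 1) ≤
      T.model M j k (T.center k) - T.model M j k (T.candidate k)
  accept : ∀ k, c.eta₁ ≤ T.ratio M j k → T.center (k + 1) = T.candidate k
  reject : ∀ k, T.ratio M j k < c.eta₁ → T.center (k + 1) = T.center k
  radius_unsuccessful : ∀ k, T.ratio M j k < c.eta₁ →
    T.radius (k + 1) ∈ Icc (c.gamma₁ * T.radius k) (c.gamma₂ * T.radius k)
  radius_successful : ∀ k, T.ratio M j k ∈ Ico c.eta₁ c.eta₂ →
    T.radius (k + 1) ∈ Icc (c.gamma₂ * T.radius k) (T.radius k)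
  radius_very_successful : ∀ k, c.eta₂ ≤ T.ratio M j k →
    T.radius (k + 1) ∈ Icc (T.radius k) c.radMax

end Trajectory

end TopOpt

end

/-! A Galerkin solution depends on a basis Φ only through the orthogonal projection `Φ * Φᵀ`. On the
design box every model is therefore a slice of one C² function of (projection, design),
`galerkinObjective`, and J is its slice at the identity. Projections and designs range over a
compact set. Hence, whatever the truncations, the curvatures β_k are bounded
(`exists_hessianBound_le`), J is bounded below, and the model error is at most a constant times the
residual norm (`exists_abs_objective_sub_romObjective_le`).

In the trust region that norm is at most Δ_k^(1/(1-ε)), which is superlinear in Δ_k. The model is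
exact at the center, because u⋆ lies in the range of the basis, so actual and predicted reductions
differ by O(Δ_k^(1/(1-ε))). If χ ≥ δ eventually, the Cauchy condition predicts at least a multiple
of Δ_k for small Δ_k. Small radii then give very successful steps, the radius stays away from zero,
and infinitely many accepted steps each lower J by a fixed amount, contradicting its lower bound
(`frequently_criticality_lt`). -/

namespace TopOpt

/-! ### Convergence of the scalar trust-region recursion. -/

section TrustRegion

/-- Convergence of an error-aware trust-region iteration, in terms of the scalar sequences that it
generates: criticality `χ`, model curvature `β`, radius `Δ`, objective value `J`, actual and
predicted reductions `a` and `p`.  The model error is superlinear in the radius. -/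
theorem frequently_criticality_lt (c : Parameters) {χ β Δ J a p : ℕ → ℝ} {B C s Jmin : ℝ}
    (hχ : ∀ k, 0 ≤ χ k) (hβ : ∀ k, 0 < β k) (hβB : ∀ k, β k ≤ B) (hΔ0 : 0 < Δ 0)
    (hJ : ∀ k, Jmin ≤ J k) (hs : 0 < s) (hC : 0 < C)
    (herr : ∀ k, 0 < Δ k → |a k - p k| ≤ C * Δ k ^ (1 + s))
    (hcauchy : ∀ k, c.kappa * χ k * min (χ k / β k) (min (c.kappa' * Δ k) 1) ≤ p k)
    (haccept : ∀ k, c.eta₁ ≤ a k / p k → J (k + 1) = J k - a k)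
    (hreject : ∀ k, a k / p k < c.eta₁ → J (k + 1) = J k)
    (hr0 : ∀ k, a k / p k < c.eta₁ → Δ (k + 1) ∈ Icc (c.gamma₁ * Δ k) (c.gamma₂ * Δ k))
    (hr1 : ∀ k, a k / p k ∈ Ico c.eta₁ c.eta₂ → Δ (k + 1) ∈ Icc (c.gamma₂ * Δ k) (Δ k))
    (hr2 : ∀ k, c.eta₂ ≤ a k / p k → Δ (k + 1) ∈ Icc (Δ k) c.radMax)
    {δ : ℝ} (hδ : 0 < δ) : ∃ᶠ k in atTop, χ k < δ := by
  obtain ⟨hg1, hg12, hg2, he1, he12, he2, hκ, hκ'⟩ :=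
    And.intro c.gamma₁_pos <| And.intro c.gamma₁_lt <| And.intro c.gamma₂_lt <|
    And.intro c.eta₁_pos <| And.intro c.eta₁_lt <| And.intro c.eta₂_lt <|
    And.intro c.kappa_pos c.kappa'_pos
  have hΔ : ∀ k, 0 < Δ k := by
    intro k
    induction k with
    | zero => exact hΔ0
    | succ k ih =>
      rcases lt_or_ge (a k / p k) c.eta₁ with h | h
      · exact (mul_pos hg1 ih).trans_le (hr0 k h).1
      · rcases lt_or_ge (a k / p k) c.eta₂ with h' | h'
        · exact (mul_pos (hg1.trans hg12) ih).trans_le (hr1 k ⟨h, h'⟩).1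
        · exact ih.trans_le (hr2 k h').1
  have hp : ∀ k, 0 ≤ p k := fun k => le_trans (by
    have := hχ k; have := hβ k; have := hΔ k; positivity) (hcauchy k)
  have hpa : ∀ k, c.eta₁ ≤ a k / p k → c.eta₁ * p k ≤ a k := by
    intro k h
    -- A zero predicted reduction gives ratio 0 by the division convention, which is below η₁, so
    -- acceptance forces `p k` to be positive.
    have hpk : 0 < p k := by
      rcases (hp k).eq_or_lt with h0 | h0
      · rw [← h0, div_zero] at h; linarith
      · exact h0
    rwa [le_div_iff₀ hpk] at h
  have hanti : ∀ k, J (k + 1) ≤ J k := by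
    intro k
    rcases lt_or_ge (a k / p k) c.eta₁ with h | h
    · exact (hreject k h).le
    · rw [haccept k h]
      have := hpa k h
      have := mul_nonneg he1.le (hp k)
      linarith
  by_contra hcon
  rw [not_frequently] at hcon
  obtain ⟨N, hN⟩ := eventually_atTop.1 hcon
  have hN' : ∀ k, N ≤ k → δ ≤ χ k := fun k hk => not_lt.1 (hN k hk)
  have hB : 0 < B := (hβ 0).trans_le (hβB 0)
  have hpred : ∀ k, N ≤ k → c.kappa * δ * min (δ / B) (min (c.kappa' * Δ k) 1) ≤ p k := by
    intro k hk
    refine le_trans ?_ (hcauchy k)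
    have := hβ k; have := hΔ k; have := hN' k hk; have := hβB k; have := hχ k
    gcongr
  -- below the radius `D` every step is very successful
  obtain ⟨D, hD, hDsucc⟩ : ∃ D > 0, ∀ k, N ≤ k → Δ k ≤ D → c.eta₂ ≤ a k / p k := by
    -- Chosen so that `C * Δ k * q` is (1 - η₂) times the Cauchy bound κ δ κ' Δ. The first two
    -- bounds on the radius make κ'Δ the active term of the Cauchy minimum; the third gives Δ^s ≤ q.
    set q := (1 - c.eta₂) * (c.kappa * δ * c.kappa') / C with hq
    have hqpos : 0 < q := by
      have : 0 < 1 - c.eta₂ := by linarith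
      positivity
    refine ⟨min (δ / B / c.kappa') (min (1 / c.kappa') (q ^ s⁻¹)), by positivity, ?_⟩
    intro k hk hle
    have hk0 := hΔ k
    simp only [le_min_iff, le_div_iff₀ hκ'] at hle
    obtain ⟨h1, h2, h3⟩ := hle
    have hpk := hpred k hk
    have e1 : c.kappa' * Δ k ≤ 1 := by linarith
    have e2 : c.kappa' * Δ k ≤ δ / B := by linarith
    rw [min_eq_left e1, min_eq_right e2] at hpk
    have hpos : 0 < p k := lt_of_lt_of_le (by positivity) hpk
    have h4 : Δ k ^ s ≤ q := by
      calc Δ k ^ s ≤ (q ^ s⁻¹) ^ s := Real.rpow_le_rpow hk0.le h3 hs.le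
        _ = q := Real.rpow_inv_rpow hqpos.le hs.ne'
    have h5 := herr k hk0
    rw [Real.rpow_add hk0, Real.rpow_one] at h5
    have h6 : |a k - p k| ≤ (1 - c.eta₂) * p k := by
      calc |a k - p k| ≤ C * (Δ k * Δ k ^ s) := h5
        _ ≤ C * (Δ k * q) := by gcongr
        _ = (1 - c.eta₂) * (c.kappa * δ * (c.kappa' * Δ k)) := by rw [hq]; field_simp
        _ ≤ (1 - c.eta₂) * p k := mul_le_mul_of_nonneg_left hpk (by linarith)
    rw [le_div_iff₀ hpos]
    have := (abs_le.1 h6).1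
    linarith
  -- At or below `D` the radius cannot shrink, and from above `D` one update shrinks it by at most
  -- the factor γ₁.
  obtain ⟨D', hD', hlow⟩ : ∃ D' > 0, ∀ k, N ≤ k → D' ≤ Δ k := by
    refine ⟨min (Δ N) (c.gamma₁ * D), lt_min (hΔ N) (mul_pos hg1 hD), fun k hk => ?_⟩
    induction k, hk using Nat.le_induction with
    | base => exact min_le_left _ _
    | succ k hk ih =>
      rcases le_or_gt (Δ k) D with hkD | hkD
      · exact ih.trans (hr2 k (hDsucc k hk hkD)).1
      · refine (min_le_right _ _).trans ?_
        have h1 : c.gamma₁ * D ≤ c.gamma₁ * Δ k := by gcongr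
        rcases lt_or_ge (a k / p k) c.eta₁ with h | h
        · exact h1.trans (hr0 k h).1
        · rcases lt_or_ge (a k / p k) c.eta₂ with h' | h'
          · refine h1.trans (le_trans ?_ (hr1 k ⟨h, h'⟩).1)
            have := hΔ k
            gcongr
          · refine h1.trans (le_trans ?_ (hr2 k h').1)
            have := hΔ k
            nlinarith
  set t := c.eta₁ * (c.kappa * δ * min (δ / B) (min (c.kappa' * D') 1)) with ht
  have htpos : 0 < t := by positivity
  have hdec : ∀ k, N ≤ k → c.eta₁ ≤ a k / p k → J (k + 1) ≤ J k - t := by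
    intro k hk h
    rw [haccept k h]
    have h1 := hpa k h
    have h2 : t ≤ c.eta₁ * p k := by
      refine mul_le_mul_of_nonneg_left (le_trans ?_ (hpred k hk)) he1.le
      have := hlow k hk
      gcongr
    linarith
  -- Rejections alone would shrink the radius geometrically, below its floor `D'`.
  have hsucc : ∀ m, N ≤ m → ∃ k, m ≤ k ∧ c.eta₁ ≤ a k / p k := by
    intro m hm
    by_contra! hno
    have hgeo : ∀ i, Δ (m + i) ≤ c.gamma₂ ^ i * Δ m := by
      intro i
      induction i with
      | zero => simp
      | succ i ih =>
        calc Δ (m + (i + 1)) ≤ c.gamma₂ * Δ (m + i) := (hr0 (m + i) (hno _ (by omega))).2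
          _ ≤ c.gamma₂ * (c.gamma₂ ^ i * Δ m) :=
            mul_le_mul_of_nonneg_left ih (hg1.trans hg12).le
          _ = c.gamma₂ ^ (i + 1) * Δ m := by ring
    obtain ⟨i, hi⟩ := exists_pow_lt_of_lt_one (div_pos hD' (hΔ m)) hg2
    rw [lt_div_iff₀ (hΔ m)] at hi
    have := hlow (m + i) (by omega)
    linarith [hgeo i]
  have hmono : Antitone J := antitone_nat_of_succ_le hanti
  have hmany : ∀ i : ℕ, ∃ m, N ≤ m ∧ J m ≤ J N - i * t := by
    intro i
    induction i with
    | zero => exact ⟨N, le_rfl, by simp⟩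
    | succ i ih =>
      obtain ⟨m, hm, hJm⟩ := ih
      obtain ⟨k, hk, hk'⟩ := hsucc m hm
      refine ⟨k + 1, by omega, ?_⟩
      have h1 := hdec k (by omega) hk'
      have h2 := hmono hk
      push_cast
      linarith
  obtain ⟨i, hi⟩ := exists_nat_gt ((J N - Jmin) / t)
  rw [div_lt_iff₀ htpos] at hi
  obtain ⟨m, -, hm⟩ := hmany i
  linarith [hJ m]

end TrustRegion

/-! ### Galerkin solutions as functions of a projection and a design. -/

section Galerkin

open scoped Matrix.Norms.Operator

variable {Ne Nu Nv : ℕ}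

theorem densityBox_eq_pi : densityBox Ne = Set.pi univ fun _ => Icc (0 : ℝ) 1 := by
  ext; simp only [densityBox, mem_ofPred_eq, mem_univ_pi]

theorem isCompact_densityBox : IsCompact (densityBox Ne) := by
  rw [densityBox_eq_pi]; exact isCompact_univ_pi fun _ => isCompact_Icc

theorem convex_densityBox : Convex ℝ (densityBox Ne) := by
  rw [densityBox_eq_pi]; exact convex_pi fun _ _ => convex_Icc _ _

theorem uniqueDiffOn_densityBox : UniqueDiffOn ℝ (densityBox Ne) := by
  rw [densityBox_eq_pi]; exact .univ_pi fun _ => uniqueDiffOn_Icc zero_lt_one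

theorem designBox_eq_preimage :
    designBox Ne = EuclideanSpace.equiv (Fin Ne) ℝ ⁻¹' densityBox Ne := rfl

theorem uniqueDiffOn_designBox : UniqueDiffOn ℝ (designBox Ne) := by
  rw [designBox_eq_preimage, ContinuousLinearEquiv.uniqueDiffOn_preimage_iff]
  exact uniqueDiffOn_densityBox

theorem isCompact_designBox : IsCompact (designBox Ne) := by
  rw [designBox_eq_preimage]
  exact (EuclideanSpace.equiv (Fin Ne) ℝ).toHomeomorph.isCompact_preimage.2 isCompact_densityBox

theorem contDiff_matrix_apply {m : ℕ} {N : WithTop ℕ∞} (i k : Fin m) :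
    ContDiff ℝ N fun A : Matrix (Fin m) (Fin m) ℝ => A i k :=
  (Matrix.entryLinearMap ℝ ℝ i k).toContinuousLinearMap.contDiff

theorem _root_.ContDiffOn.matrix_mulVec {E : Type*} [NormedAddCommGroup E] [NormedSpace ℝ E]
    {m : ℕ} {N : WithTop ℕ∞} {A : E → Matrix (Fin m) (Fin m) ℝ} {v : E → Fin m → ℝ} {s : Set E}
    (hA : ContDiffOn ℝ N A s) (hv : ContDiffOn ℝ N v s) :
    ContDiffOn ℝ N (fun x => A x *ᵥ v x) s := by
  rw [contDiffOn_pi]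
  intro i
  have h : ∀ k, ContDiffOn ℝ N (fun x => A x i k * v x k) s := fun k =>
    ((contDiff_matrix_apply i k).comp_contDiffOn hA).mul (contDiffOn_pi.1 hv k)
  change ContDiffOn ℝ N (fun x => ∑ k, A x i k * v x k) s
  exact ContDiffOn.sum fun k _ => h k

/-- The set of (matrices of) orthogonal projections. -/
def projections (m : ℕ) : Set (Matrix (Fin m) (Fin m) ℝ) := {A | Aᵀ = A ∧ A * A = A}

theorem one_mem_projections {m : ℕ} : 1 ∈ projections m := ⟨by simp, by simp⟩

/-- For a symmetric idempotent A, the diagonal of A = A Aᵀ reads A_ii = ∑ A_ik². So A_ii² ≤ A_ii,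
whence A_ii ≤ 1 and all entries lie in [-1, 1]. -/
theorem isCompact_projections (m : ℕ) : IsCompact (projections m) := by
  have hc : IsClosed (projections m) := by
    have h1 : IsClosed {A : Matrix (Fin m) (Fin m) ℝ | Aᵀ = A} :=
      isClosed_eq (by fun_prop) (by fun_prop)
    have h2 : IsClosed {A : Matrix (Fin m) (Fin m) ℝ | A * A = A} :=
      isClosed_eq (by fun_prop) (by fun_prop)
    exact h1.inter h2
  have hK : IsCompact (Set.pi univ fun _ : Fin m => Set.pi univ fun _ : Fin m =>
      Icc (-1 : ℝ) 1) := isCompact_univ_pi fun _ => isCompact_univ_pi fun _ => isCompact_Icc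
  refine hK.of_isClosed_subset hc ?_
  intro (A : Matrix (Fin m) (Fin m) ℝ) ⟨hA, hAA⟩
  have hdiag : ∀ i, A i i = ∑ k, A i k * A i k := fun i => by
    conv_lhs => rw [← hAA, Matrix.mul_apply]
    refine Finset.sum_congr rfl fun k _ => ?_
    rw [← congrFun (congrFun hA k) i, Matrix.transpose_apply]
  have hle : ∀ i k, A i k * A i k ≤ A i i := fun i k => by
    rw [hdiag i]
    exact Finset.single_le_sum (f := fun k => A i k * A i k) (fun _ _ => mul_self_nonneg _)
      (Finset.mem_univ k)
  intro i _ k _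
  have h1 := hle i i
  have h2 := hle i k
  exact abs_le.1 (sq_le_one_iff_abs_le_one _ |>.1 (by nlinarith [sq_nonneg (A i i - 1)]))

namespace Discretization

variable (M : Discretization Ne Nu Nv)

theorem contDiff_filteredDensity {N : WithTop ℕ∞} : ContDiff ℝ N M.filteredDensity := by
  unfold filteredDensity nodalDensity helmholtzLoad
  simp only [Matrix.mulVec, dotProduct, Finset.sum_apply, Pi.smul_apply, smul_eq_mul]
  fun_prop

theorem contDiff_stiffness {N : WithTop ℕ∞} : ContDiff ℝ N M.stiffness := by
  unfold stiffness alpha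
  fun_prop

/-- The constant part ρ_l of α contributes a positive multiple of the solid stiffness; the rest is
positive semidefinite. -/
theorem stiffness_posDef {ρ : Fin Ne → ℝ} (hρ : ρ ∈ densityBox Ne) : (M.stiffness ρ).PosDef := by
  have hE : ∀ e, (M.P e * M.Ke e * (M.P e)ᵀ).PosSemidef := fun e => by
    simpa using (M.Ke_posSemidef e).mul_mul_conjTranspose_same (M.P e)
  have hsplit : M.stiffness ρ = M.rhoMin • (∑ e, M.P e * M.Ke e * (M.P e)ᵀ) +
      ∑ e, ((1 - M.rhoMin) * ρ e ^ M.p) • (M.P e * M.Ke e * (M.P e)ᵀ) := by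
    simp only [stiffness, alpha, add_smul, Finset.sum_add_distrib, Finset.smul_sum]
  rw [hsplit]
  refine (M.solid_posDef.smul M.rhoMin_pos).add_posSemidef (Matrix.posSemidef_sum _ fun e _ => ?_)
  exact (hE e).smul (mul_nonneg (by linarith [M.rhoMin_lt_one]) (pow_nonneg (hρ e).1 _))

/-- The Galerkin matrix of a projection `Π`, extended by the identity on the kernel of `Π`. -/
noncomputable def galerkinMatrix (q : Matrix (Fin Nu) (Fin Nu) ℝ × Design Ne) : Matrix (Fin Nu) (Fin Nu) ℝ :=
  q.1 * M.stiffness (M.filteredDensity q.2) * q.1 + (1 - q.1)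

/-- The Galerkin solution in the range of a projection. -/
noncomputable def galerkinState (q : Matrix (Fin Nu) (Fin Nu) ℝ × Design Ne) : Fin Nu → ℝ :=
  (M.galerkinMatrix q)⁻¹ *ᵥ (q.1 *ᵥ M.load)

/-- The pairs for which the Galerkin matrix is invertible. -/
def regularSet : Set (Matrix (Fin Nu) (Fin Nu) ℝ × Design Ne) :=
  {q | q.2 ∈ designBox Ne ∧ IsUnit (M.galerkinMatrix q)}

variable {M}

theorem contDiff_galerkinMatrix {N : WithTop ℕ∞} : ContDiff ℝ N M.galerkinMatrix := by
  have h : ContDiff ℝ N fun q : Matrix (Fin Nu) (Fin Nu) ℝ × Design Ne =>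
      M.stiffness (M.filteredDensity q.2) :=
    M.contDiff_stiffness.comp (M.contDiff_filteredDensity.comp contDiff_snd)
  unfold galerkinMatrix
  exact ((contDiff_fst.mul h).mul contDiff_fst).add (contDiff_const.sub contDiff_fst)

/-- The projections are in general too thin a set for unique derivatives. Derivatives are therefore
taken on this relatively open superset, and compactness of the projections only bounds them. -/
theorem uniqueDiffOn_regularSet : UniqueDiffOn ℝ M.regularSet := by
  have h1 : UniqueDiffOn ℝ ((univ : Set (Matrix (Fin Nu) (Fin Nu) ℝ)) ×ˢ designBox Ne) :=
    uniqueDiffOn_univ.prod uniqueDiffOn_designBox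
  have h2 : IsOpen {q | IsUnit (M.galerkinMatrix q)} :=
    Units.isOpen.preimage (contDiff_galerkinMatrix (N := 0)).continuous
  convert h1.inter h2 using 1
  ext q; simp [regularSet]

theorem contDiffOn_galerkinMatrix_inv {N : WithTop ℕ∞} :
    ContDiffOn ℝ N (fun q => (M.galerkinMatrix q)⁻¹) M.regularSet := by
  intro q hq
  obtain ⟨x, hx⟩ := hq.2
  have h := contDiffAt_ringInverse ℝ (n := N) x
  rw [hx] at h
  simp only [Matrix.nonsing_inv_eq_ringInverse]
  exact (h.comp q contDiff_galerkinMatrix.contDiffAt).contDiffWithinAt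

theorem contDiffOn_galerkinState {N : WithTop ℕ∞} :
    ContDiffOn ℝ N M.galerkinState M.regularSet :=
  contDiffOn_galerkinMatrix_inv.matrix_mulVec (contDiffOn_fst.matrix_mulVec contDiffOn_const)

/-- If (AKA + 1 - A)x = 0, applying 1 - A gives x = Ax. What remains is AKx = 0, so x·Kx = Ax·Kx =
x·AKx = 0 and x = 0 by positive definiteness. -/
theorem isUnit_galerkinMatrix {q : Matrix (Fin Nu) (Fin Nu) ℝ × Design Ne}
    (hq : q.1 ∈ projections Nu) (hρ : M.filteredDensity q.2 ∈ densityBox Ne) :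
    IsUnit (M.galerkinMatrix q) := by
  obtain ⟨A, ψ⟩ := q
  obtain ⟨hA, hAA⟩ := hq
  simp only at hA hAA hρ
  have hK := M.stiffness_posDef hρ
  rw [← Matrix.mulVec_injective_iff_isUnit]
  refine (injective_iff_map_eq_zero (M.galerkinMatrix (A, ψ)).mulVecLin).2 fun x hx => ?_
  simp only [Matrix.mulVecLin_apply, galerkinMatrix] at hx
  set K := M.stiffness (M.filteredDensity ψ)
  have h1 : (1 - A) * (A * K * A + (1 - A)) = 1 - A := by
    have : A * (A * K * A) = A * K * A := by simp only [← mul_assoc, hAA]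
    rw [sub_mul, one_mul, mul_add, this, mul_sub, mul_one, hAA]; abel
  have h2 : A *ᵥ x = x := by
    have := congrArg (fun y => (1 - A) *ᵥ y) hx
    simp only [Matrix.mulVec_mulVec, h1, Matrix.mulVec_zero, Matrix.sub_mulVec,
      Matrix.one_mulVec] at this
    exact (sub_eq_zero.1 this).symm
  by_contra hne
  have h3 := hK.dotProduct_mulVec_pos hne
  have h4 : A *ᵥ (K *ᵥ x) = 0 := by
    rw [Matrix.add_mulVec, Matrix.sub_mulVec, Matrix.one_mulVec, h2, sub_self, add_zero,
      ← Matrix.mulVec_mulVec, h2, ← Matrix.mulVec_mulVec] at hx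
    exact hx
  have h5 : x ⬝ᵥ K *ᵥ x = 0 := by
    nth_rewrite 1 [← h2]
    rw [← Matrix.vecMul_transpose, hA, ← Matrix.dotProduct_mulVec, h4, dotProduct_zero]
  simp only [star_trivial] at h3
  exact h3.ne' h5

/-- Membership in the range of A and the projected equation determine the Galerkin solution; the
full and the reduced solutions are both identified through this criterion. -/
theorem galerkinState_eq {A : Matrix (Fin Nu) (Fin Nu) ℝ} {ψ : Design Ne}
    (hA : A ∈ projections Nu) (hρ : M.filteredDensity ψ ∈ densityBox Ne) {u : Fin Nu → ℝ}
    (h1 : A *ᵥ u = u)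
    (h2 : A *ᵥ (M.stiffness (M.filteredDensity ψ) *ᵥ u) = A *ᵥ M.load) :
    u = M.galerkinState (A, ψ) := by
  have hdet := (Matrix.isUnit_iff_isUnit_det _).1 (isUnit_galerkinMatrix (q := (A, ψ)) hA hρ)
  have h3 : M.galerkinMatrix (A, ψ) *ᵥ u = A *ᵥ M.load := by
    simp only [galerkinMatrix]
    rw [Matrix.add_mulVec, Matrix.sub_mulVec, Matrix.one_mulVec, h1, sub_self, add_zero,
      ← Matrix.mulVec_mulVec, h1, ← Matrix.mulVec_mulVec, h2]
  rw [galerkinState, ← h3, Matrix.mulVec_mulVec, Matrix.nonsing_inv_mul _ hdet,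
    Matrix.one_mulVec]

theorem stiffness_mulVec_state {ψ : Design Ne} (hρ : M.filteredDensity ψ ∈ densityBox Ne) :
    M.stiffness (M.filteredDensity ψ) *ᵥ M.state ψ = M.load := by
  have hdet := (Matrix.isUnit_iff_isUnit_det _).1 (M.stiffness_posDef hρ).isUnit
  rw [state, Matrix.mulVec_mulVec, Matrix.mul_nonsing_inv _ hdet, Matrix.one_mulVec]

theorem state_eq_galerkinState {ψ : Design Ne} (hρ : M.filteredDensity ψ ∈ densityBox Ne) :
    M.state ψ = M.galerkinState (1, ψ) :=
  galerkinState_eq one_mem_projections hρ (Matrix.one_mulVec _)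
    (by rw [stiffness_mulVec_state hρ])

section Basis

variable {ι : Type} [Fintype ι] [DecidableEq ι] {Φ : Matrix (Fin Nu) ι ℝ}

theorem _root_.TopOpt.mul_transpose_mem_projections (hΦ : Φᵀ * Φ = 1) :
    Φ * Φᵀ ∈ projections Nu := by
  refine ⟨by simp, ?_⟩
  rw [Matrix.mul_assoc, ← Matrix.mul_assoc Φᵀ, hΦ, Matrix.one_mul]

theorem romState_eq_galerkinState (hΦ : Φᵀ * Φ = 1) {ψ : Design Ne}
    (hρ : M.filteredDensity ψ ∈ densityBox Ne) :
    M.romState Φ ψ = M.galerkinState (Φ * Φᵀ, ψ) := by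
  have hinj : Function.Injective Φ.mulVec := by
    refine Function.LeftInverse.injective (g := fun y => Φᵀ *ᵥ y) fun x => ?_
    simp only [Matrix.mulVec_mulVec, hΦ, Matrix.one_mulVec]
  have hpos := (M.stiffness_posDef hρ).conjTranspose_mul_mul_same hinj
  rw [Matrix.conjTranspose_eq_transpose_of_trivial] at hpos
  have hdet := (Matrix.isUnit_iff_isUnit_det _).1 hpos.isUnit
  refine galerkinState_eq (mul_transpose_mem_projections hΦ) hρ ?_ ?_
  · rw [romState, Matrix.mulVec_mulVec, Matrix.mul_assoc, hΦ, Matrix.mul_one]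
  · rw [romState, ← Matrix.mulVec_mulVec, ← Matrix.mulVec_mulVec]
    congr 1
    rw [Matrix.mulVec_mulVec, Matrix.mulVec_mulVec, Matrix.mulVec_mulVec,
      Matrix.mul_nonsing_inv _ hdet, Matrix.one_mulVec]

/-- The exact state solves the projected equation for any basis, so it is the reduced solution as
soon as the basis spans it. -/
theorem romState_eq_state (hΦ : Φᵀ * Φ = 1) {ψ : Design Ne}
    (hρ : M.filteredDensity ψ ∈ densityBox Ne) {w : ι → ℝ} (hw : Φ *ᵥ w = M.state ψ) :
    M.romState Φ ψ = M.state ψ := by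
  rw [romState_eq_galerkinState hΦ hρ]
  refine (galerkinState_eq (mul_transpose_mem_projections hΦ) hρ ?_ ?_).symm
  · rw [← hw, Matrix.mulVec_mulVec, Matrix.mul_assoc, hΦ, Matrix.mul_one]
  · rw [stiffness_mulVec_state hρ]

end Basis

end Discretization

/-! ### Properties of the Gram–Schmidt basis. -/

theorem gramSchmidtBasis_transpose_mul_self {N m : ℕ} (c : Fin m → EuclideanSpace ℝ (Fin N)) :
    (gramSchmidtBasis c)ᵀ * gramSchmidtBasis c = 1 := by
  have h := InnerProductSpace.gramSchmidtNormed_orthonormal' (𝕜 := ℝ) c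
  rw [orthonormal_iff_ite] at h
  ext i k
  rw [Matrix.one_apply, ← h i k, Matrix.mul_apply, PiLp.inner_apply]
  exact Finset.sum_congr rfl fun a _ => mul_comm _ _

/-- The dropped vectors are zero, so discarding them leaves the span unchanged. -/
theorem exists_gramSchmidtBasis_mulVec {N m : ℕ} (c : Fin m → EuclideanSpace ℝ (Fin N))
    (i : Fin m) : ∃ w, gramSchmidtBasis c *ᵥ w = (c i).ofLp := by
  have h1 : c i ∈ Submodule.span ℝ (range (InnerProductSpace.gramSchmidtNormed ℝ c)) := by
    rw [InnerProductSpace.span_gramSchmidtNormed_range, InnerProductSpace.span_gramSchmidt]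
    exact Submodule.subset_span (mem_range_self i)
  have h2 : c i ∈ Submodule.span ℝ
      (range fun k : GramSchmidtIndex c => InnerProductSpace.gramSchmidtNormed ℝ c k) := by
    refine Submodule.span_le.2 ?_ h1
    rintro _ ⟨k, rfl⟩
    by_cases hk : InnerProductSpace.gramSchmidtNormed ℝ c k = 0
    · rw [hk]; exact Submodule.zero_mem _
    · exact Submodule.subset_span ⟨⟨k, hk⟩, rfl⟩
  obtain ⟨w, hw⟩ := (Submodule.mem_span_range_iff_exists_fun ℝ).1 h2
  refine ⟨w, ?_⟩
  rw [← hw]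
  ext a
  simp [gramSchmidtBasis, Matrix.mulVec, dotProduct, mul_comm]

end Galerkin

end TopOpt

namespace TopOpt

/-! ### Bounds uniform over all reduced bases. -/

section Bounds

open scoped Matrix.Norms.Operator

variable {Ne Nu Nv : ℕ}

/-- The first derivative is the constant map `inr`, of norm at most 1, and the higher ones vanish.
This controls the inner map when a slice is written as a composition. -/
theorem norm_iteratedFDerivWithin_prodMk_le {E F : Type*} [NormedAddCommGroup E]
    [NormedSpace ℝ E] [NormedAddCommGroup F] [NormedSpace ℝ F] (a : E) {s : Set F}
    (hs : UniqueDiffOn ℝ s) {x : F} (hx : x ∈ s) {i : ℕ} (hi : 1 ≤ i) :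
    ‖iteratedFDerivWithin ℝ i (fun y => (a, y)) s x‖ ≤ 1 := by
  obtain ⟨i, rfl⟩ := Nat.exists_eq_add_of_le' hi
  have hd : ∀ y ∈ s, fderivWithin ℝ (fun y => (a, y)) s y = ContinuousLinearMap.inr ℝ E F :=
    fun y hy => (hasFDerivAt_prodMk_right a y).hasFDerivWithinAt.fderivWithin (hs y hy)
  rw [← norm_iteratedFDerivWithin_fderivWithin hs hx, iteratedFDerivWithin_congr hd hx]
  rcases Nat.eq_zero_or_pos i with rfl | hi0
  · rw [norm_iteratedFDerivWithin_zero]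
    exact ContinuousLinearMap.norm_inr_le_one ℝ E F
  · rw [iteratedFDerivWithin_const_of_ne hi0.ne']
    simp

/-- A `C¹` function on `univ × P`, `P` compact and convex, is Lipschitz in its first argument,
uniformly on balls. -/
theorem exists_lipschitz_left {E F : Type*} [NormedAddCommGroup E] [NormedSpace ℝ E]
    [ProperSpace E] [NormedAddCommGroup F] [NormedSpace ℝ F] {P : Set F} (hP : IsCompact P)
    (hPc : Convex ℝ P) (hPu : UniqueDiffOn ℝ P) {j : E × F → ℝ}
    (hj : ContDiffOn ℝ 1 j (univ ×ˢ P)) (R : ℝ) :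
    ∃ L, 0 ≤ L ∧ ∀ u v ρ, ‖u‖ ≤ R → ‖v‖ ≤ R → ρ ∈ P →
      |j (u, ρ) - j (v, ρ)| ≤ L * ‖u - v‖ := by
  have hU : UniqueDiffOn ℝ ((univ : Set E) ×ˢ P) := uniqueDiffOn_univ.prod hPu
  have hsub : Metric.closedBall (0 : E) R ×ˢ P ⊆ univ ×ˢ P := prod_mono (subset_univ _) le_rfl
  have hcont := (hj.continuousOn_fderivWithin hU le_rfl).mono hsub
  obtain ⟨L, hL⟩ := ((isCompact_closedBall (0 : E) R).prod hP).exists_bound_of_continuousOn hcont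
  refine ⟨max L 0, le_max_right _ _, fun u v ρ hu hv hρ => ?_⟩
  have hder : ∀ x ∈ Metric.closedBall (0 : E) R ×ˢ P, HasFDerivWithinAt j
      (fderivWithin ℝ j (univ ×ˢ P) x) (Metric.closedBall (0 : E) R ×ˢ P) x := fun x hx =>
    ((hj.differentiableOn one_ne_zero x (hsub hx)).hasFDerivWithinAt).mono hsub
  have h := ((convex_closedBall (0 : E) R).prod hPc).norm_image_sub_le_of_norm_hasFDerivWithin_le
    (C := max L 0) hder (fun x hx => (hL x hx).trans (le_max_left _ _))
    (x := (v, ρ)) (y := (u, ρ)) ⟨by simpa using hv, hρ⟩ ⟨by simpa using hu, hρ⟩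
  simpa [Prod.norm_def] using h

namespace Discretization

variable (M : Discretization Ne Nu Nv) {j : (Fin Nu → ℝ) × (Fin Ne → ℝ) → ℝ}

/-- The objective at the Galerkin solution in the range of a projection. -/
noncomputable def galerkinObjective (j : (Fin Nu → ℝ) × (Fin Ne → ℝ) → ℝ)
    (q : Matrix (Fin Nu) (Fin Nu) ℝ × Design Ne) : ℝ :=
  j (M.galerkinState q, M.filteredDensity q.2)

variable {M}

theorem projections_prod_subset_regularSet
    (hfilter : ∀ ψ ∈ designBox Ne, M.filteredDensity ψ ∈ densityBox Ne) :
    projections Nu ×ˢ designBox Ne ⊆ M.regularSet :=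
  fun _ hq => ⟨hq.2, isUnit_galerkinMatrix hq.1 (hfilter _ hq.2)⟩

theorem contDiffOn_galerkinObjective
    (hfilter : ∀ ψ ∈ designBox Ne, M.filteredDensity ψ ∈ densityBox Ne)
    (hj : ContDiffOn ℝ 2 j (univ ×ˢ densityBox Ne)) :
    ContDiffOn ℝ 2 (M.galerkinObjective j) M.regularSet := by
  have h : ContDiffOn ℝ 2 (fun q => (M.galerkinState q, M.filteredDensity q.2)) M.regularSet :=
    contDiffOn_galerkinState.prodMk
      (M.contDiff_filteredDensity.comp_contDiffOn contDiffOn_snd)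
  exact hj.comp h fun q hq => ⟨mem_univ _, hfilter _ hq.1⟩

theorem isCompact_projections_prod : IsCompact (projections Nu ×ˢ designBox Ne) :=
  (isCompact_projections Nu).prod isCompact_designBox

theorem exists_hessianBound_le
    (hfilter : ∀ ψ ∈ designBox Ne, M.filteredDensity ψ ∈ densityBox Ne)
    (hj : ContDiffOn ℝ 2 j (univ ×ˢ densityBox Ne)) (V : ℝ) :
    ∃ B, ∀ {ι : Type} [Fintype ι] [DecidableEq ι] (Φ : Matrix (Fin Nu) ι ℝ), Φᵀ * Φ = 1 →
      hessianBound M V (M.romObjective j Φ) ≤ B := by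
  have hG := contDiffOn_galerkinObjective hfilter hj
  have hsub := projections_prod_subset_regularSet hfilter
  have hb : ∀ i : ℕ, i ≤ 2 → ∃ C, ∀ q ∈ projections Nu ×ˢ designBox Ne,
      ‖iteratedFDerivWithin ℝ i (M.galerkinObjective j) M.regularSet q‖ ≤ C := fun i hi =>
    isCompact_projections_prod.exists_bound_of_continuousOn
      ((hG.continuousOn_iteratedFDerivWithin (by exact_mod_cast hi) uniqueDiffOn_regularSet).mono
        hsub)
  obtain ⟨C0, h0⟩ := hb 0 (by norm_num)
  obtain ⟨C1, h1⟩ := hb 1 (by norm_num)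
  obtain ⟨C2, h2⟩ := hb 2 le_rfl
  set C := max 0 (max C0 (max C1 C2)) with hC
  have hC0 : 0 ≤ C := le_max_left _ _
  -- The chain-rule estimate for second derivatives is 2! · C · 1².
  refine ⟨1 + 2 * C, fun Φ hΦ => ?_⟩
  refine add_le_add le_rfl (Real.sSup_le ?_ (by positivity))
  rintro _ ⟨ψ, hψ, rfl⟩
  have hψ := hψ.1
  have hA := mul_transpose_mem_projections hΦ
  have hcongr : ∀ y ∈ designBox Ne,
      M.romObjective j Φ y = (M.galerkinObjective j ∘ fun y => (Φ * Φᵀ, y)) y := fun y hy => by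
    simp only [romObjective, galerkinObjective, Function.comp,
      romState_eq_galerkinState hΦ (hfilter y hy)]
  simp only
  rw [iteratedFDerivWithin_congr hcongr hψ]
  have h := norm_iteratedFDerivWithin_comp_le (n := 2) (C := C) (D := 1) hG
    (f := fun y => (Φ * Φᵀ, y)) (s := designBox Ne) (x := ψ)
    (contDiff_prodMk_right (Φ * Φᵀ)).contDiffOn le_rfl uniqueDiffOn_regularSet
    uniqueDiffOn_designBox (fun y hy => hsub ⟨hA, hy⟩) hψ
    (fun i hi => by
      interval_cases i
      · exact (h0 _ ⟨hA, hψ⟩).trans (by simp [hC])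
      · exact (h1 _ ⟨hA, hψ⟩).trans (by simp [hC])
      · exact (h2 _ ⟨hA, hψ⟩).trans (by simp [hC]))
    (fun i hi _ => by
      rw [one_pow]
      exact norm_iteratedFDerivWithin_prodMk_le _ uniqueDiffOn_designBox hψ hi)
  simpa using h

theorem exists_le_objective
    (hfilter : ∀ ψ ∈ designBox Ne, M.filteredDensity ψ ∈ densityBox Ne)
    (hj : ContDiffOn ℝ 2 j (univ ×ˢ densityBox Ne)) :
    ∃ B, ∀ ψ ∈ designBox Ne, B ≤ M.objective j ψ := by
  obtain ⟨C, hC⟩ := isCompact_projections_prod.exists_bound_of_continuousOn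
    ((contDiffOn_galerkinObjective hfilter hj).continuousOn.mono
      (projections_prod_subset_regularSet hfilter))
  refine ⟨-C, fun ψ hψ => ?_⟩
  have h := hC (1, ψ) ⟨one_mem_projections, hψ⟩
  rw [galerkinObjective, ← state_eq_galerkinState (hfilter ψ hψ)] at h
  exact (abs_le.1 h).1

/-- The error of the reduced objective is bounded by the norm of the residual. -/
theorem exists_abs_objective_sub_romObjective_le
    (hfilter : ∀ ψ ∈ designBox Ne, M.filteredDensity ψ ∈ densityBox Ne)
    (hj : ContDiffOn ℝ 2 j (univ ×ˢ densityBox Ne)) :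
    ∃ C, 0 ≤ C ∧ ∀ {ι : Type} [Fintype ι] [DecidableEq ι] (Φ : Matrix (Fin Nu) ι ℝ),
      Φᵀ * Φ = 1 → ∀ ψ ∈ designBox Ne,
      |M.objective j ψ - M.romObjective j Φ ψ| ≤ C * M.romResidualNorm Φ ψ := by
  have hsub := projections_prod_subset_regularSet hfilter
  obtain ⟨R, hR⟩ := isCompact_projections_prod.exists_bound_of_continuousOn
    ((contDiffOn_galerkinState (N := 0)).continuousOn.mono hsub)
  obtain ⟨D, hD⟩ := isCompact_projections_prod.exists_bound_of_continuousOn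
    ((contDiffOn_galerkinMatrix_inv (N := 0)).continuousOn.mono hsub)
  obtain ⟨L, hL0, hL⟩ := exists_lipschitz_left isCompact_densityBox convex_densityBox
    uniqueDiffOn_densityBox (hj.of_le one_le_two) R
  refine ⟨L * max D 0, by positivity, fun Φ hΦ ψ hψ => ?_⟩
  have hρ := hfilter ψ hψ
  have hs := state_eq_galerkinState hρ
  have hr := romState_eq_galerkinState hΦ hρ
  have h1 := hL (M.state ψ) (M.romState Φ ψ) (M.filteredDensity ψ)
    (hs ▸ hR (1, ψ) ⟨one_mem_projections, hψ⟩)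
    (hr ▸ hR (Φ * Φᵀ, ψ) ⟨mul_transpose_mem_projections hΦ, hψ⟩) hρ
  refine h1.trans ?_
  rw [mul_assoc]
  refine mul_le_mul_of_nonneg_left ?_ hL0
  -- The error equals K⁻¹ applied to the residual, and at the identity projection the Galerkin
  -- matrix is K itself, so `D` bounds K⁻¹. The operator norm is the one for the sup norm, which the
  -- Euclidean norm dominates.
  have hdet := (Matrix.isUnit_iff_isUnit_det _).1 (M.stiffness_posDef hρ).isUnit
  have hinv := hD (1, ψ) ⟨one_mem_projections, hψ⟩
  simp only [galerkinMatrix, one_mul, mul_one, sub_self, add_zero] at hinv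
  have herr : M.romState Φ ψ - M.state ψ = (M.stiffness (M.filteredDensity ψ))⁻¹ *ᵥ
      M.residual (M.romState Φ ψ) (M.filteredDensity ψ) := by
    rw [residual, Matrix.mulVec_sub, Matrix.mulVec_mulVec, Matrix.nonsing_inv_mul _ hdet,
      Matrix.one_mulVec, state]
  rw [norm_sub_rev, herr]
  refine (Matrix.linfty_opNorm_mulVec _ _).trans ?_
  refine mul_le_mul (hinv.trans (le_max_left _ _)) ?_ (norm_nonneg _) (le_max_right _ _)
  exact (pi_norm_le_iff_of_nonneg (norm_nonneg _)).2 fun i =>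
    PiLp.norm_apply_le (WithLp.toLp 2 (M.residual (M.romState Φ ψ) (M.filteredDensity ψ))) i

end Discretization

end Bounds

/-! ### Exactness at the centers and feasibility of the iterates. -/

namespace Trajectory

variable {Ne Nu Nv : ℕ} {n : ℕ → ℕ} {T : Trajectory Ne Nu n} {M : Discretization Ne Nu Nv}
  {j : (Fin Nu → ℝ) × (Fin Ne → ℝ) → ℝ}

/-- The model is exact at the trust-region center. -/
theorem model_center {k : ℕ} (hρ : M.filteredDensity (T.center k) ∈ densityBox Ne) :
    T.model M j k (T.center k) = M.objective j (T.center k) := by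
  -- This index is the first column after the two POD blocks, namely u⋆ at the center.
  obtain ⟨w, hw⟩ := exists_gramSchmidtBasis_mulVec (T.columns M j k)
    (Fin.natAdd (min (n k) Nu + min (n k) Nu) 0)
  have hcol : T.columns M j k (Fin.natAdd (min (n k) Nu + min (n k) Nu) 0) =
      WithLp.toLp 2 (M.state (T.center k)) := by
    rw [columns, basisColumns, Fin.append_right]; rfl
  rw [hcol] at hw
  rw [model, Discretization.romObjective, Discretization.objective,
    Discretization.romState_eq_state (gramSchmidtBasis_transpose_mul_self _) hρ hw]

theorem IsProducedBy.center_mem_feasible {V : ℝ} {c : Parameters} (hT : T.IsProducedBy M j V c)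
    (k : ℕ) : T.center k ∈ M.feasible V := by
  induction k with
  | zero => exact hT.center_zero_mem
  | succ k ih =>
    rcases lt_or_ge (T.ratio M j k) c.eta₁ with h | h
    · rwa [hT.reject k h]
    · rw [hT.accept k h]; exact (hT.candidate_mem k).1

end Trajectory

theorem hessianBound_pos {Ne Nu Nv : ℕ} (M : Discretization Ne Nu Nv) (V : ℝ)
    (m : Design Ne → ℝ) : 0 < hessianBound M V m := by
  have : 0 ≤ sSup ((fun ψ => ‖iteratedFDerivWithin ℝ 2 m (designBox Ne) ψ‖) '' M.feasible V) :=
    Real.sSup_nonneg (by rintro _ ⟨ψ, -, rfl⟩; exact norm_nonneg _)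
  exact add_pos_of_pos_of_nonneg one_pos this

end TopOpt

/-! ### Assembly of the theorem. -/

theorem theorem4p3 {Ne Nu Nv : ℕ} (M : TopOpt.Discretization Ne Nu Nv)
    (hfilter : ∀ ψ ∈ TopOpt.designBox Ne, M.filteredDensity ψ ∈ TopOpt.densityBox Ne)
    (j : (Fin Nu → ℝ) × (Fin Ne → ℝ) → ℝ)
    (hj : ContDiffOn ℝ 2 j (Set.univ ×ˢ TopOpt.densityBox Ne))
    (V : ℝ) (hV : ∑ e, M.rhoMin * M.vol e ≤ V)
    (c : TopOpt.Parameters)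
    (n : ℕ → ℕ) (hn : ∀ k, n k ≤ k - 1)
    (T : TopOpt.Trajectory Ne Nu n) (hT : T.IsProducedBy M j V c) :
    Filter.liminf (fun k => ((M.criticality j V (T.center k) : ℝ) : EReal)) Filter.atTop = 0 := by
  have hcenter := hT.center_mem_feasible
  have hexact : ∀ k, T.model M j k (T.center k) = M.objective j (T.center k) := fun k =>
    TopOpt.Trajectory.model_center (hfilter _ (hcenter k).1)
  obtain ⟨B, hB⟩ := TopOpt.Discretization.exists_hessianBound_le hfilter hj V
  obtain ⟨Jmin, hJmin⟩ := TopOpt.Discretization.exists_le_objective hfilter hj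
  obtain ⟨C, hC, herr⟩ :=
    TopOpt.Discretization.exists_abs_objective_sub_romObjective_le hfilter hj
  have hΦ := fun k => TopOpt.gramSchmidtBasis_transpose_mul_self (T.columns M j k)
  have heps : 0 < 1 - c.eps := by linarith [c.eps_lt]
  have hmodel : ∀ k, 0 < T.radius k →
      |(M.objective j (T.center k) - M.objective j (T.candidate k)) -
        (T.model M j k (T.center k) - T.model M j k (T.candidate k))| ≤
      (C + 1) * T.radius k ^ (1 + c.eps / (1 - c.eps)) := by
    intro k hk
    obtain ⟨hfeas, htr⟩ := hT.candidate_mem k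
    have h1 := herr _ (hΦ k) _ hfeas.1
    have hres : M.romResidualNorm (TopOpt.gramSchmidtBasis (T.columns M j k)) (T.candidate k) ≤
        T.radius k ^ (1 + c.eps / (1 - c.eps)) := by
      -- The constraint bounds the residual to the power 1 - ε by the radius; inverting the power
      -- gives the excess exponent s = ε/(1-ε).
      have he : 1 + c.eps / (1 - c.eps) = (1 - c.eps)⁻¹ := by field_simp; ring
      rw [he]
      exact (Real.le_rpow_inv_iff_of_pos (norm_nonneg _) hk.le heps).2 htr
    -- Exactness at the center cancels the objective values there, leaving only the model error at
    -- the candidate.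
    rw [hexact k, show ∀ a b d : ℝ, a - b - (a - d) = -(b - d) by intros; ring, abs_neg]
    refine h1.trans (mul_le_mul (by linarith) hres (norm_nonneg _) (by linarith))
  have hfreq : ∀ δ : ℝ, 0 < δ → ∃ᶠ k in atTop, M.criticality j V (T.center k) < δ :=
    fun δ hδ => TopOpt.frequently_criticality_lt c (fun k => abs_nonneg _)
      (fun k => TopOpt.hessianBound_pos M V (T.model M j k)) (fun k => hB _ (hΦ k))
      hT.radius_zero_pos (J := fun k => M.objective j (T.center k))
      (fun k => hJmin _ (hcenter k).1) (div_pos c.eps_pos heps) (by linarith) hmodel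
      hT.cauchy_decrease
      (fun k h => by simp only [hT.accept k h]; ring)
      (fun k h => by simp only [hT.reject k h])
      hT.radius_unsuccessful hT.radius_successful hT.radius_very_successful hδ
  refine le_antisymm (EReal.le_of_forall_lt_iff_le.1 fun δ hδ => ?_) ?_
  · refine liminf_le_of_frequently_le' ((hfreq δ (by exact_mod_cast hδ)).mono fun k hk => ?_)
    exact_mod_cast hk.le
  · refine le_liminf_of_le (by isBoundedDefault) (Eventually.of_forall fun k => ?_)
    exact_mod_cast abs_nonneg _
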